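/- For a positive integer $r$ let $N_3(1,r)$ be the number of triples $(x,y,z)$ of residue classes modulo $r$ with $x^2+y^2+z^2\equiv 1 \pmod r$, and let $G=\sum_{n\ge 0}\frac{(-1)^n}{(2n+1)^2}$ be the Catalan constant. Then, as $x\to\infty$ through real numbers, $$\sum_{1\le r\le x} N_3(1,r)=\frac{36\,G}{\pi^4}\,x^3+O(x^2\log x).$$ Moreover, for all $r\ge 1$, $$N_3(1,r)=\sum_{d\mid r} \left(\frac{r}{d}\right)^2 f(d),$$ where $f$ is the multiplicative function defined on prime powers $p^\nu$ ($\nu\ge 1$) by $f(p)=p$ if $p\equiv 1 \pmod 4$, $f(p)=-p$ if $p\equiv -1 \pmod 4$, $f(4)=8$, and $f(p^\nu)=0$ in all other cases. -/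

import Mathlib

open Asymptotics Filter

/-- `numSol k n r` is the number of incongruent solutions modulo `r` of
`x₁² + ⋯ + x_k² ≡ n (mod r)`, that is, the number of `k`-tuples of residue classes modulo `r`
whose squares add up to the class of `n`. It is meant for `r ≥ 1` (where the set is finite). -/
noncomputable def numSol (k : ℕ) (n : ℤ) (r : ℕ) : ℕ :=
  Nat.card {x : Fin k → ZMod r // ∑ i, x i ^ 2 = (n : ZMod r)}

/-- The Catalan constant `G = ∑_{n ≥ 0} (-1)ⁿ / (2n+1)²` (an absolutely convergent series). -/
noncomputable def catalanConst : ℝ :=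
  ∑' n : ℕ, (-1 : ℝ) ^ n / (2 * (n : ℝ) + 1) ^ 2

/-- The value at the prime power `p ^ ν` (`ν ≥ 1`) of the multiplicative function `f`
with `N₃(1, ·) = id₂ * f`. -/
def fPrimePow (p ν : ℕ) : ℤ :=
  if p % 4 = 1 ∧ ν = 1 then (p : ℤ)
  else if p % 4 = 3 ∧ ν = 1 then -(p : ℤ)
  else if p = 2 ∧ ν = 2 then 8
  else 0

/-!
Write `N(r) = numSol 3 1 r`. By the Chinese remainder theorem `N` is multiplicative, so the
convolution identity `N = id² * f` is a statement about prime powers.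

* If every class modulo `n` lifting `1` modulo a divisor `m` is the square of a unit `u`, then
  scaling by `u` identifies the spheres of all these radii, and double counting gives
  `N(n) / n² = N(m) / m²`. This applies to `m = p ^ ν`, `n = p ^ (ν + 1)` as soon as `p` is odd and
  `ν ≥ 1`, or `p = 2` and `ν ≥ 3` (`numSol_prime_pow_succ`), so `f(p ^ (ν + 1)) = 0` there.
* For an odd prime, `N(p) = p² + χ₄(p) p` by quadratic characters and the Jacobi sum
  `J(χ, χ⁻¹) = -χ(-1)` (`card_sphere`). The moduli `2`, `4`, `8` are counted by enumeration.

Hence `f(n) = χ₄(n) μ(n)² n` for `4 ∤ n` and `f(4n) = 8 χ₄(n) μ(n)² n` (`sphereCoeff`); in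
particular `|f(n)| ≤ 2n`. Comparing Euler products factor by factor yields
`(∑ f(n) / n³) ζ(4) = (6/5) L(2, χ₄)`, where `6/5` comes from the prime `2`; since
`L(2, χ₄) = G` and `ζ(4) = π⁴ / 90`, the series `∑ f(n) / n³` equals `108 G / π⁴`.

Finally `∑_{r ≤ x} N(r) = ∑_{d ≤ x} f(d) ∑_{m ≤ x/d} m²`, and `∑_{m ≤ y} m² = y³/3 + O(y²)`. The
error terms contribute at most a constant times `∑_{d ≤ x} d (x/d)² ≪ x² log x`, and completing
`∑_{d ≤ x} f(d) / d³` to the full series costs `O(x³ · 1/x) = O(x²)`.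
-/

/-! ### Double counting -/

/-- Double counting: if all fibres of `ψ` over the points satisfying `Q` have `k` elements, then
`ψ ⁻¹' Q` has `k` times as many elements as `Q`. -/
theorem Nat.card_subtype_comp_of_card_fiber {A B : Type*} [Finite A] [Finite B] (ψ : A → B)
    (Q : B → Prop) {k : ℕ} (hk : ∀ b, Q b → Nat.card {a // ψ a = b} = k) :
    Nat.card {a // Q (ψ a)} = Nat.card {b // Q b} * k := by
  have := Fintype.ofFinite {b // Q b}
  have e : {a // Q (ψ a)} ≃ Σ b : {b // Q b}, {a // ψ a = b} :=
    { toFun := fun a => ⟨⟨ψ a, a.2⟩, ⟨a, rfl⟩⟩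
      invFun := fun s => ⟨s.2, by rw [s.2.2]; exact s.1.2⟩
      left_inv := fun a => rfl
      right_inv := by
        rintro ⟨⟨b, hb⟩, ⟨a, ha⟩⟩
        dsimp only at ha
        subst ha
        rfl }
  rw [Nat.card_congr e, Nat.card_sigma, Finset.sum_congr rfl (fun b _ => hk b.1 b.2)]
  simp

/-- A surjective homomorphism of finite groups preserves densities of subsets under preimage. -/
theorem AddMonoidHom.card_preimage_mul_card {A B : Type*} [AddGroup A] [AddGroup B] [Finite A]
    [Finite B] (φ : A →+ B) (hφ : Function.Surjective φ) (P : B → Prop) :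
    Nat.card {a // P (φ a)} * Nat.card B = Nat.card {b // P b} * Nat.card A := by
  classical
  have := Fintype.ofFinite A
  have hfib (b : B) : Nat.card {a // φ a = b} = Nat.card {a // φ a = 0} := by
    rw [Nat.card_eq_fintype_card, Nat.card_eq_fintype_card, Fintype.card_subtype,
      Fintype.card_subtype]
    exact AddMonoidHom.card_fiber_eq_of_mem_range φ (hφ _) (hφ _)
  have h1 := Nat.card_subtype_comp_of_card_fiber φ P fun b _ => hfib b
  have h2 := Nat.card_subtype_comp_of_card_fiber φ (fun _ => True) fun b _ => hfib b
  rw [Nat.card_congr (Equiv.subtypeUnivEquiv fun _ : A => trivial),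
    Nat.card_congr (Equiv.subtypeUnivEquiv fun _ : B => trivial)] at h2
  rw [h1, h2]
  ring

/-! ### Lifting solutions to higher moduli -/

/-- Both sides, up to the factor `n / m`, count the triples modulo `n` whose squares add up to
`1` modulo `m`: by reduction modulo `m`, and by the value of the sum of squares modulo `n`. The
hypothesis makes all these values equally frequent, since scaling by `u` turns the value `1` into
`u ^ 2`. -/
theorem numSol_mul_sq_of_lifts_of_one_isSquare {m n : ℕ} [NeZero m] [NeZero n] (h : m ∣ n)
    (hsq : ∀ a : ZMod n, ZMod.castHom h (ZMod m) a = 1 → ∃ u : (ZMod n)ˣ, a = (u : ZMod n) ^ 2) :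
    numSol 3 1 n * m ^ 2 = numSol 3 1 m * n ^ 2 := by
  set c := ZMod.castHom h (ZMod m) with hc
  have hcs : Function.Surjective c := ZMod.castHom_surjective h
  have A := AddMonoidHom.card_preimage_mul_card (c : ZMod n →+ ZMod m) hcs (fun b => b = 1)
  have B := AddMonoidHom.card_preimage_mul_card
    ((c : ZMod n →+ ZMod m).compLeft (Fin 3)) (hcs.comp_left)
    (fun x => ∑ i, x i ^ 2 = ((1 : ℤ) : ZMod m))
  -- scaling by `u`, where `a = u ^ 2`, maps the solutions for `1` onto those for `a`
  have hfib (a : ZMod n) (ha : c a = 1) :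
      Nat.card {x : Fin 3 → ZMod n // ∑ i, x i ^ 2 = a} = numSol 3 1 n := by
    obtain ⟨u, rfl⟩ := hsq a ha
    refine (Nat.card_congr ((MulAction.toPerm u).subtypeEquiv fun x => ?_)).symm
    have : ∑ i, (u • x) i ^ 2 = (u : ZMod n) ^ 2 * ∑ i, x i ^ 2 := by
      rw [Finset.mul_sum]
      exact Finset.sum_congr rfl fun i _ => by
        simp only [Pi.smul_apply, Units.smul_def, smul_eq_mul]; ring
    rw [MulAction.toPerm_apply, this]
    constructor
    · intro h; rw [h]; simp
    · intro h
      have := congrArg (fun t => ((u⁻¹ : (ZMod n)ˣ) : ZMod n) ^ 2 * t) h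
      simpa [← mul_assoc, ← mul_pow] using this
  have C : Nat.card {x : Fin 3 → ZMod n // ∑ i, (c (x i)) ^ 2 = ((1 : ℤ) : ZMod m)} =
      Nat.card {a : ZMod n // c a = 1} * numSol 3 1 n := by
    rw [← Nat.card_subtype_comp_of_card_fiber (fun x : Fin 3 → ZMod n => ∑ i, x i ^ 2)
      (fun a => c a = 1) hfib]
    simp
  change Nat.card {a : ZMod n // c a = 1} * _ = _ at A
  change Nat.card {x : Fin 3 → ZMod n // ∑ i, (c (x i)) ^ 2 = ((1 : ℤ) : ZMod m)} * _ =
    numSol 3 1 m * _ at B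
  rw [C] at B
  simp only [Nat.card_eq_fintype_card, Fintype.card_subtype_eq, ZMod.card, one_mul, Fintype.card_fun,
    Fintype.card_fin] at A B
  have hn : 0 < n := NeZero.pos n
  apply Nat.eq_of_mul_eq_mul_left hn
  calc n * (numSol 3 1 n * m ^ 2) =
      (Fintype.card {a : ZMod n // c a = 1} * m) * numSol 3 1 n * m ^ 2 := by rw [A]; ring
    _ = _ := by linear_combination B

/-- The lifting lemma applies because of `1 + p ^ ν k = (1 + p ^ ν k / 2) ^ 2` for odd `p`, and
`1 + 2 ^ ν k = (1 + 2 ^ (ν - 1) k) ^ 2` for `p = 2`. In the latter case `3 ≤ ν` guarantees that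
the cross term `2 ^ (2 ν - 2) k ^ 2` vanishes modulo `2 ^ (ν + 1)`. -/
theorem numSol_prime_pow_succ {p ν : ℕ} (hp : p.Prime) (h : p ≠ 2 ∧ 1 ≤ ν ∨ 3 ≤ ν) :
    numSol 3 1 (p ^ (ν + 1)) = p ^ 2 * numSol 3 1 (p ^ ν) := by
  have := Fact.mk hp
  have key := numSol_mul_sq_of_lifts_of_one_isSquare (m := p ^ ν) (n := p ^ (ν + 1))
    (pow_dvd_pow p ν.le_succ) ?_
  · have hpos : 0 < (p ^ ν) ^ 2 := by have := hp.pos; positivity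
    apply Nat.eq_of_mul_eq_mul_right hpos
    rw [key]; ring
  intro a ha
  -- a lift of `1` is `1 + p ^ ν * k`
  obtain ⟨k, hk⟩ : ∃ k : ZMod (p ^ (ν + 1)), a = 1 + (p : ZMod (p ^ (ν + 1))) ^ ν * k := by
    have h0 : ZMod.castHom (pow_dvd_pow p ν.le_succ) (ZMod (p ^ ν)) (a - 1) = 0 := by
      rw [map_sub, ha, map_one, sub_self]
    have h1 : ((a - 1).val : ZMod (p ^ ν)) = 0 := by
      rw [← ZMod.natCast_zmod_val (a - 1), map_natCast] at h0
      exact h0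
    obtain ⟨j, hj⟩ := (ZMod.natCast_eq_zero_iff _ _).1 h1
    refine ⟨j, ?_⟩
    have := congrArg (Nat.cast : ℕ → ZMod (p ^ (ν + 1))) hj
    rw [ZMod.natCast_zmod_val] at this
    push_cast at this
    rw [← this]; ring
  have hpow {j : ℕ} (hj : ν + 1 ≤ j) : (p : ZMod (p ^ (ν + 1))) ^ j = 0 := by
    rw [← Nat.cast_pow]
    exact (ZMod.natCast_eq_zero_iff _ _).2 (pow_dvd_pow p hj)
  suffices ∃ s : ZMod (p ^ (ν + 1)), a = s ^ 2 ∧ IsUnit s by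
    obtain ⟨s, hs, u, rfl⟩ := this
    exact ⟨u, hs⟩
  have hunit {j : ℕ} (hj : 1 ≤ j) (t : ZMod (p ^ (ν + 1))) :
      IsUnit (1 + (p : ZMod (p ^ (ν + 1))) ^ j * t) := by
    refine IsNilpotent.isUnit_one_add ⟨ν + 1, ?_⟩
    rw [mul_pow, ← pow_mul, hpow (by nlinarith), zero_mul]
  by_cases h2 : p = 2
  · have h3 : 3 ≤ ν := by omega
    refine ⟨1 + (p : ZMod (p ^ (ν + 1))) ^ (ν - 1) * k, ?_, hunit (by omega) k⟩
    have e1 : (p : ZMod (p ^ (ν + 1))) ^ ν = 2 * (p : ZMod (p ^ (ν + 1))) ^ (ν - 1) := by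
      obtain ⟨μ, rfl⟩ : ∃ μ, ν = μ + 1 := ⟨ν - 1, by omega⟩
      have hc : (p : ZMod (p ^ (μ + 1 + 1))) = 2 := by
        exact_mod_cast congrArg (Nat.cast : ℕ → ZMod (p ^ (μ + 1 + 1))) h2
      exact (pow_succ' _ _).trans (by rw [hc, Nat.add_sub_cancel])
    have e2 : ((p : ZMod (p ^ (ν + 1))) ^ (ν - 1)) ^ 2 = 0 := by
      rw [← pow_mul]; exact hpow (by omega)
    rw [hk, e1]
    linear_combination (-k ^ 2) * e2
  · have h1 : 1 ≤ ν := by omega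
    have hu : IsUnit ((2 : ℕ) : ZMod (p ^ (ν + 1))) := by
      rw [ZMod.isUnit_iff_coprime]
      exact Nat.Coprime.pow_right _ ((Nat.coprime_primes Nat.prime_two hp).2 (Ne.symm h2))
    obtain ⟨w, hw⟩ := hu.exists_right_inv
    refine ⟨1 + (p : ZMod (p ^ (ν + 1))) ^ ν * (w * k), ?_, hunit h1 _⟩
    have e2 : ((p : ZMod (p ^ (ν + 1))) ^ ν) ^ 2 = 0 := by
      rw [← pow_mul]; exact hpow (by omega)
    rw [hk]
    push_cast at hw
    linear_combination (-(w * k) ^ 2) * e2 - (p : ZMod (p ^ (ν + 1))) ^ ν * k * hw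

/-! ### Multiplicativity and small moduli -/

theorem numSol_mul_of_coprime {k m n : ℕ} {c : ℤ} (h : m.Coprime n) :
    numSol k c (m * n) = numSol k c m * numSol k c n := by
  let e := ZMod.chineseRemainder h
  have he (x : Fin k → ZMod (m * n)) :
      ∑ i, x i ^ 2 = (c : ZMod (m * n)) ↔
        ∑ i, (e (x i)).1 ^ 2 = (c : ZMod m) ∧ ∑ i, (e (x i)).2 ^ 2 = (c : ZMod n) := by
    rw [← e.injective.eq_iff, Prod.ext_iff]
    simp [Prod.fst_sum, Prod.snd_sum]
  rw [numSol, numSol, numSol, ← Nat.card_prod]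
  refine Nat.card_congr (Equiv.trans (Equiv.subtypeEquiv
    (((Equiv.refl (Fin k)).arrowCongr e.toEquiv).trans
      (Equiv.arrowProdEquivProdArrow (Fin k) (fun _ => ZMod m) (fun _ => ZMod n)))
    (q := fun y => (∑ i, y.1 i ^ 2 = (c : ZMod m)) ∧ ∑ i, y.2 i ^ 2 = (c : ZMod n)) ?_)
    (Equiv.subtypeProdEquivProd (p := fun x : Fin k → ZMod m => ∑ i, x i ^ 2 = (c : ZMod m))
      (q := fun x : Fin k → ZMod n => ∑ i, x i ^ 2 = (c : ZMod n))))
  exact he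

theorem numSol_one (k : ℕ) (c : ℤ) : numSol k c 1 = 1 := by
  rw [numSol, Nat.card_eq_one_iff_unique]
  exact ⟨inferInstance, ⟨⟨0, Subsingleton.elim _ _⟩⟩⟩

/-- Reformulation over a product type, on which the count can be evaluated by the kernel. -/
theorem numSol_three_eq_card_prod (c : ℤ) (r : ℕ) [NeZero r] :
    numSol 3 c r = Fintype.card {x : ZMod r × ZMod r × ZMod r //
      x.1 ^ 2 + x.2.1 ^ 2 + x.2.2 ^ 2 = (c : ZMod r)} := by
  rw [numSol, ← Nat.card_eq_fintype_card]
  refine Nat.card_congr ⟨fun x => ⟨(x.1 0, x.1 1, x.1 2), ?_⟩,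
    fun x => ⟨![x.1.1, x.1.2.1, x.1.2.2], ?_⟩, fun x => ?_, fun x => ?_⟩
  · simpa [Fin.sum_univ_three] using x.2
  · simpa [Fin.sum_univ_three] using x.2
  · ext i; fin_cases i <;> rfl
  · rfl

theorem numSol_three_one_two : numSol 3 1 2 = 4 := by
  rw [numSol_three_eq_card_prod]; decide +kernel

theorem numSol_three_one_four : numSol 3 1 4 = 24 := by
  rw [numSol_three_eq_card_prod]; decide +kernel

theorem numSol_three_one_eight : numSol 3 1 8 = 96 := by
  rw [numSol_three_eq_card_prod]; decide +kernel

/-! ### Points on the unit sphere over a finite field -/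

section QuadraticCharSums

variable {F : Type*} [Field F] [Fintype F] [DecidableEq F]

/-- A value `a` is attained by `y ↦ y ^ 2` exactly `1 + χ(a)` times. -/
theorem sum_comp_sq (hF : ringChar F ≠ 2) (g : F → ℤ) :
    ∑ y, g (y ^ 2) = ∑ a, (1 + quadraticChar F a) * g a := by
  rw [← Finset.sum_fiberwise (s := Finset.univ) (g := fun y : F => y ^ 2)]
  refine Finset.sum_congr rfl fun a _ => ?_
  rw [Finset.sum_congr rfl (g := fun _ => g a)
    (fun y hy => by rw [(Finset.mem_filter.1 hy).2]), Finset.sum_const, nsmul_eq_mul]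
  congr 1
  rw [add_comm, ← quadraticChar_card_sqrts hF a]
  congr 2
  ext y
  simp

/-- For `c ≠ 0` this is the Jacobi sum of `χ` with `χ⁻¹ = χ`, after rescaling by `c`. -/
theorem sum_quadraticChar_mul_quadraticChar_sub (hF : ringChar F ≠ 2) (c : F) :
    ∑ a, quadraticChar F a * quadraticChar F (c - a) =
      quadraticChar F (-1) * ((if c = 0 then (Fintype.card F : ℤ) else 0) - 1) := by
  by_cases hc : c = 0
  · subst hc
    have (a : F) : quadraticChar F a * quadraticChar F (0 - a) =
        quadraticChar F (-1) * (1 - if a = 0 then 1 else 0) := by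
      rw [zero_sub, neg_eq_neg_one_mul a, map_mul, mul_left_comm, ← map_mul, ← sq]
      by_cases ha : a = 0
      · simp [ha]
      · rw [quadraticChar_sq_one' ha]; simp [ha]
    rw [Finset.sum_congr rfl fun a _ => this a, ← Finset.mul_sum, Finset.sum_sub_distrib]
    simp
  · have J := jacobiSum_nontrivial_inv (quadraticChar_ne_one hF)
    rw [(quadraticChar_isQuadratic F).inv, jacobiSum] at J
    rw [← Equiv.sum_comp (Equiv.mulLeft₀ c hc), if_neg hc, zero_sub, mul_neg_one, ← J]
    refine Finset.sum_congr rfl fun a _ => ?_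
    rw [Equiv.mulLeft₀_apply, ← mul_one_sub, map_mul, map_mul]
    linear_combination (quadraticChar F a * quadraticChar F (1 - a)) * quadraticChar_sq_one hc

theorem card_sphere (hF : ringChar F ≠ 2) :
    (Fintype.card {x : F × F × F // x.1 ^ 2 + x.2.1 ^ 2 + x.2.2 ^ 2 = 1} : ℤ) =
      Fintype.card F ^ 2 + quadraticChar F (-1) * Fintype.card F := by
  have h1 (c : F) : ∑ x : F, (if x ^ 2 = c then 1 else 0 : ℤ) = 1 + quadraticChar F c := by
    rw [sum_comp_sq hF (fun t => if t = c then 1 else 0)]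
    simp
  have h2 (c : F) : ∑ y : F, (1 + quadraticChar F (c - y ^ 2)) = Fintype.card F +
      quadraticChar F (-1) * ((if c = 0 then (Fintype.card F : ℤ) else 0) - 1) := by
    rw [sum_comp_sq hF (fun t => 1 + quadraticChar F (c - t)),
      ← sum_quadraticChar_mul_quadraticChar_sub hF c]
    have h3 : ∑ a, quadraticChar F (c - a) = 0 := by
      rw [← quadraticChar_sum_zero hF]
      exact (Equiv.subLeft c).sum_comp (quadraticChar F)
    simp only [add_mul, one_mul, mul_add, mul_one, Finset.sum_add_distrib, h3,
      quadraticChar_sum_zero hF]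
    simp
  -- for fixed `y` and `z`, count the square roots `x` of `1 - z ^ 2 - y ^ 2`
  have h3 : (Fintype.card {x : F × F × F // x.1 ^ 2 + x.2.1 ^ 2 + x.2.2 ^ 2 = 1} : ℤ) =
      ∑ z : F, ∑ y : F, ∑ x : F, if x ^ 2 = 1 - z ^ 2 - y ^ 2 then 1 else 0 := by
    rw [Fintype.card_subtype, Finset.card_filter, Fintype.sum_prod_type_right,
      Fintype.sum_prod_type_right]
    push_cast
    refine Finset.sum_congr rfl fun z _ => Finset.sum_congr rfl fun y _ =>
      Finset.sum_congr rfl fun x _ => if_congr ?_ rfl rfl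
    constructor <;> intro h <;> linear_combination h
  rw [h3]
  simp only [h1, h2]
  rw [sum_comp_sq hF (fun t => (Fintype.card F : ℤ) +
    quadraticChar F (-1) * ((if 1 - t = 0 then (Fintype.card F : ℤ) else 0) - 1))]
  have h4 (a : F) : (1 + quadraticChar F a) * ((Fintype.card F : ℤ) +
      quadraticChar F (-1) * ((if 1 - a = 0 then (Fintype.card F : ℤ) else 0) - 1)) =
      (1 + quadraticChar F a) * (Fintype.card F - quadraticChar F (-1)) +
      if 1 = a then (1 + quadraticChar F a) * quadraticChar F (-1) * Fintype.card F else 0 := by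
    by_cases h : 1 = a
    · simp [← h]; ring
    · rw [if_neg h, if_neg (sub_ne_zero.2 h)]; ring
  rw [Finset.sum_congr rfl fun a _ => h4 a, Finset.sum_add_distrib, ← Finset.sum_mul,
    Finset.sum_add_distrib, quadraticChar_sum_zero hF, Finset.sum_ite_eq]
  simp
  ring

end QuadraticCharSums

theorem numSol_three_one_prime {p : ℕ} (hp : p.Prime) (h2 : p ≠ 2) :
    (numSol 3 1 p : ℤ) = p ^ 2 + ZMod.χ₄ p * p := by
  have := Fact.mk hp
  have hF : ringChar (ZMod p) ≠ 2 := by rwa [ZMod.ringChar_zmod_n]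
  have := card_sphere hF
  rw [quadraticChar_neg_one hF, ZMod.card] at this
  rw [numSol_three_eq_card_prod, ← this]
  simp

/-! ### The multiplicative function `f` and the convolution identity -/

/-- The function `n ↦ χ₄(n) μ(n)² n`, supported on the odd squarefree numbers. -/
def twistedSquarefree (n : ℕ) : ℤ := ZMod.χ₄ n * ArithmeticFunction.moebius n ^ 2 * n

theorem twistedSquarefree_one : twistedSquarefree 1 = 1 := by
  simp [twistedSquarefree]

theorem twistedSquarefree_mul {m n : ℕ} (h : m.Coprime n) :
    twistedSquarefree (m * n) = twistedSquarefree m * twistedSquarefree n := by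
  simp only [twistedSquarefree, ArithmeticFunction.isMultiplicative_moebius.map_mul_of_coprime h,
    Nat.cast_mul, map_mul]
  ring

theorem twistedSquarefree_prime {p : ℕ} (hp : p.Prime) :
    twistedSquarefree p = ZMod.χ₄ p * p := by
  simp [twistedSquarefree, ArithmeticFunction.moebius_apply_prime hp]

theorem twistedSquarefree_prime_pow {p ν : ℕ} (hp : p.Prime) (hν : 2 ≤ ν) :
    twistedSquarefree (p ^ ν) = 0 := by
  have : ArithmeticFunction.moebius (p ^ ν) = 0 := by
    rw [ArithmeticFunction.moebius_apply_prime_pow hp (by omega), if_neg (by omega)]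
  rw [twistedSquarefree, this]
  simp

theorem abs_twistedSquarefree_le (n : ℕ) : |twistedSquarefree n| ≤ n := by
  have h1 : |ZMod.χ₄ (n : ZMod 4)| ≤ 1 := by
    rcases ZMod.isQuadratic_χ₄ (n : ZMod 4) with h | h | h <;> simp [h]
  have h2 : |ArithmeticFunction.moebius n ^ 2| ≤ 1 := by
    rw [ArithmeticFunction.moebius_sq]; split_ifs <;> simp
  rw [twistedSquarefree, abs_mul, abs_mul, Nat.abs_cast]
  have := mul_le_mul h1 h2 (abs_nonneg _) zero_le_one
  nlinarith [n.cast_nonneg (α := ℤ)]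

/-- The multiplicative function `f` with `N₃(1, ·) = id₂ * f`, in closed form. -/
def sphereCoeff : ArithmeticFunction ℤ where
  toFun n := if 4 ∣ n then 8 * twistedSquarefree (n / 4) else twistedSquarefree n
  map_zero' := by simp [twistedSquarefree]

theorem sphereCoeff_apply (n : ℕ) : sphereCoeff n =
    if 4 ∣ n then 8 * twistedSquarefree (n / 4) else twistedSquarefree n := rfl

theorem isMultiplicative_sphereCoeff : sphereCoeff.IsMultiplicative := by
  have key {m n : ℕ} (h : m.Coprime n) (hm : 4 ∣ m) :
      sphereCoeff (m * n) = sphereCoeff m * sphereCoeff n := by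
    obtain ⟨k, rfl⟩ := hm
    have hn : ¬ 4 ∣ n := fun h4 => by
      have := Nat.dvd_gcd (Dvd.intro k rfl) h4
      rw [h] at this
      omega
    rw [sphereCoeff_apply, sphereCoeff_apply, sphereCoeff_apply, if_pos (Dvd.intro k rfl),
      if_neg hn, mul_assoc, if_pos (Dvd.intro _ rfl), Nat.mul_div_cancel_left _ (by norm_num),
      Nat.mul_div_cancel_left _ (by norm_num), twistedSquarefree_mul h.coprime_mul_left, mul_assoc]
  refine ⟨by simp [sphereCoeff_apply, twistedSquarefree_one], fun {m n} h => ?_⟩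
  by_cases hm : 4 ∣ m
  · exact key h hm
  by_cases hn : 4 ∣ n
  · rw [mul_comm m, key h.symm hn, mul_comm]
  have hmn : ¬ 4 ∣ m * n := fun h4 => by
    have : ¬ (2 ∣ m ∧ 2 ∣ n) := fun ⟨h1, h2⟩ => by
      have := Nat.dvd_gcd h1 h2
      rw [h] at this
      omega
    rw [not_and_or] at this
    rcases this with h2 | h2
    · exact hn (Nat.Coprime.dvd_of_dvd_mul_left
        (Nat.Coprime.pow_left 2 ((Nat.Prime.coprime_iff_not_dvd Nat.prime_two).2 h2)) h4)
    · exact hm (Nat.Coprime.dvd_of_dvd_mul_right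
        (Nat.Coprime.pow_left 2 ((Nat.Prime.coprime_iff_not_dvd Nat.prime_two).2 h2)) h4)
  rw [sphereCoeff_apply, sphereCoeff_apply, sphereCoeff_apply, if_neg hm, if_neg hn, if_neg hmn,
    twistedSquarefree_mul h]

theorem not_four_dvd_prime_pow {p ν : ℕ} (hp : p.Prime) (h2 : p ≠ 2) : ¬ 4 ∣ p ^ ν := fun h =>
  h2 ((Nat.prime_dvd_prime_iff_eq Nat.prime_two hp).1
    (Nat.prime_two.dvd_of_dvd_pow ((show 2 ∣ 4 by norm_num).trans h))).symm

theorem sphereCoeff_prime {p : ℕ} (hp : p.Prime) : sphereCoeff p = ZMod.χ₄ p * p := by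
  rw [sphereCoeff_apply, if_neg, twistedSquarefree_prime hp]
  intro h
  have := (Nat.dvd_prime hp).1 h
  rcases this with h | h
  · omega
  · subst h; revert hp; decide

theorem sphereCoeff_prime_pow {p ν : ℕ} (hp : p.Prime) (h2 : p ≠ 2) (hν : 2 ≤ ν) :
    sphereCoeff (p ^ ν) = 0 := by
  rw [sphereCoeff_apply, if_neg (not_four_dvd_prime_pow hp h2), twistedSquarefree_prime_pow hp hν]

theorem sphereCoeff_two : sphereCoeff 2 = 0 := by
  rw [sphereCoeff_prime Nat.prime_two]; decide

theorem sphereCoeff_four : sphereCoeff 4 = 8 := by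
  simp [sphereCoeff_apply, twistedSquarefree_one]

theorem sphereCoeff_two_pow {ν : ℕ} (hν : 3 ≤ ν) : sphereCoeff (2 ^ ν) = 0 := by
  obtain ⟨μ, rfl⟩ : ∃ μ, ν = 2 + (μ + 1) := ⟨ν - 3, by omega⟩
  rw [sphereCoeff_apply, pow_add, show 2 ^ 2 = 4 by norm_num, if_pos (Dvd.intro _ rfl),
    Nat.mul_div_cancel_left _ (by norm_num)]
  rcases Nat.eq_zero_or_pos μ with rfl | h
  · rw [zero_add, pow_one, twistedSquarefree_prime Nat.prime_two]; decide
  · rw [twistedSquarefree_prime_pow Nat.prime_two (by omega), mul_zero]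

theorem sphereCoeff_eq_fPrimePow {p ν : ℕ} (hp : p.Prime) (hν : 1 ≤ ν) :
    sphereCoeff (p ^ ν) = fPrimePow p ν := by
  rw [fPrimePow]
  by_cases h2 : p = 2
  · subst h2
    obtain rfl | rfl | h : ν = 1 ∨ ν = 2 ∨ 3 ≤ ν := by omega
    · simp [sphereCoeff_two]
    · simp [sphereCoeff_four]
    · rw [sphereCoeff_two_pow h]
      simp only [show ¬ ν = 1 by omega, show ¬ ν = 2 by omega, and_false, if_false]
  · rcases hν.eq_or_lt with rfl | h
    · rw [pow_one, sphereCoeff_prime hp]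
      have := hp.eq_two_or_odd
      obtain h4 | h4 : p % 4 = 1 ∨ p % 4 = 3 := by omega
      · rw [ZMod.χ₄_nat_one_mod_four h4]; simp [h4]
      · rw [ZMod.χ₄_nat_three_mod_four h4]; simp [h4]
    · rw [sphereCoeff_prime_pow hp h2 h]
      simp only [show ¬ ν = 1 by omega, h2, and_false, false_and, if_false]

theorem abs_sphereCoeff_le (n : ℕ) : |sphereCoeff n| ≤ 2 * n := by
  rw [sphereCoeff_apply]
  split_ifs with h
  · obtain ⟨k, rfl⟩ := h
    rw [Nat.mul_div_cancel_left _ (by norm_num), abs_mul]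
    have := abs_twistedSquarefree_le k
    push_cast
    norm_num
    linarith
  · have := abs_twistedSquarefree_le n
    linarith [n.cast_nonneg (α := ℤ)]

/-- The function `r ↦ N₃(1, r)` as an arithmetic function. -/
noncomputable def numSolArith : ArithmeticFunction ℤ where
  toFun r := if r = 0 then 0 else numSol 3 1 r
  map_zero' := by simp

theorem numSolArith_apply {r : ℕ} (hr : r ≠ 0) : numSolArith r = numSol 3 1 r := if_neg hr

theorem isMultiplicative_numSolArith : numSolArith.IsMultiplicative := by
  rw [ArithmeticFunction.IsMultiplicative.iff_ne_zero]
  refine ⟨by rw [numSolArith_apply one_ne_zero, numSol_one, Nat.cast_one], fun {m n} hm hn h => ?_⟩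
  rw [numSolArith_apply (mul_ne_zero hm hn), numSolArith_apply hm, numSolArith_apply hn,
    numSol_mul_of_coprime h, Nat.cast_mul]

/-- Convolution with the completely multiplicative `id ^ k` satisfies a one-step recursion along
the powers of a prime. -/
theorem pow_mul_apply_prime_pow_succ (g : ArithmeticFunction ℤ) {p : ℕ} (hp : p.Prime) (ν k : ℕ) :
    ((ArithmeticFunction.pow k : ArithmeticFunction ℤ) * g) (p ^ (ν + 1)) =
      p ^ k * ((ArithmeticFunction.pow k : ArithmeticFunction ℤ) * g) (p ^ ν) + g (p ^ (ν + 1)) := by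
  have hp0 := hp.ne_zero
  have aux (j : ℕ) : (ArithmeticFunction.pow k : ArithmeticFunction ℤ) (p ^ j) = (p ^ k) ^ j := by
    simp [ArithmeticFunction.pow_apply, hp0, ← pow_mul, mul_comm]
  rw [mul_comm _ g, ArithmeticFunction.mul_apply, ArithmeticFunction.mul_apply,
    Nat.sum_divisorsAntidiagonal (fun a b =>
      g a * (ArithmeticFunction.pow k : ArithmeticFunction ℤ) b),
    Nat.sum_divisorsAntidiagonal (fun a b =>
      g a * (ArithmeticFunction.pow k : ArithmeticFunction ℤ) b),
    Nat.sum_divisors_prime_pow hp, Nat.sum_divisors_prime_pow hp, Finset.sum_range_succ,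
    Nat.div_self (pow_pos hp.pos _), Finset.mul_sum]
  congr 1
  · refine Finset.sum_congr rfl fun i hi => ?_
    have hi' := Finset.mem_range.1 hi
    rw [Nat.pow_div (by omega) hp.pos, Nat.pow_div (by omega) hp.pos, aux, aux,
      show ν + 1 - i = (ν - i) + 1 by omega, pow_succ]
    ring
  · simp [ArithmeticFunction.pow_apply]

theorem numSolArith_eq :
    numSolArith = (ArithmeticFunction.pow 2 : ArithmeticFunction ℤ) * sphereCoeff := by
  have hR : ((ArithmeticFunction.pow 2 : ArithmeticFunction ℤ) * sphereCoeff).IsMultiplicative :=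
    ArithmeticFunction.isMultiplicative_pow.natCast.mul isMultiplicative_sphereCoeff
  rw [ArithmeticFunction.IsMultiplicative.eq_iff_eq_on_prime_powers _ isMultiplicative_numSolArith
    _ hR]
  intro p i hp
  induction i with
  | zero => rw [pow_zero, isMultiplicative_numSolArith.1, hR.1]
  | succ ν ih =>
    rw [pow_mul_apply_prime_pow_succ _ hp, ← ih, numSolArith_apply (pow_ne_zero _ hp.ne_zero),
      numSolArith_apply (pow_ne_zero _ hp.ne_zero)]
    by_cases h : p ≠ 2 ∧ 1 ≤ ν ∨ 3 ≤ ν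
    · rw [numSol_prime_pow_succ hp h]
      have : sphereCoeff (p ^ (ν + 1)) = 0 := by
        by_cases h2 : p = 2
        · subst h2; exact sphereCoeff_two_pow (by omega)
        · exact sphereCoeff_prime_pow hp h2 (by omega)
      rw [this]; push_cast; ring
    by_cases h2 : p = 2
    · subst h2
      obtain rfl | rfl | rfl : ν = 0 ∨ ν = 1 ∨ ν = 2 := by omega
      · norm_num [numSol_one, numSol_three_one_two, sphereCoeff_two]
      · norm_num [numSol_three_one_two, numSol_three_one_four, sphereCoeff_four]
      · rw [sphereCoeff_two_pow le_rfl]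
        norm_num [numSol_three_one_eight, numSol_three_one_four]
    · obtain rfl : ν = 0 := by omega
      rw [zero_add, pow_one, pow_zero, numSol_three_one_prime hp h2, numSol_one,
        sphereCoeff_prime hp]
      push_cast; ring

/-! ### The value of `∑ f(n) / n³` -/

/-- The completely multiplicative function `n ↦ χ₄(n) / n²`. -/
noncomputable def chiFourDivSq : ℕ →*₀ ℝ where
  toFun n := (ZMod.χ₄ n : ℝ) / (n : ℝ) ^ 2
  map_zero' := by simp
  map_one' := by simp
  map_mul' m n := by
    rw [Nat.cast_mul, Nat.cast_mul, map_mul, Int.cast_mul, mul_pow, mul_div_mul_comm]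

theorem chiFourDivSq_apply (n : ℕ) : chiFourDivSq n = (ZMod.χ₄ n : ℝ) / (n : ℝ) ^ 2 := rfl

/-- The completely multiplicative function `n ↦ 1 / n⁴`. -/
noncomputable def invPowFour : ℕ →*₀ ℝ where
  toFun n := 1 / (n : ℝ) ^ 4
  map_zero' := by simp
  map_one' := by simp
  map_mul' m n := by rw [Nat.cast_mul, mul_pow, one_div_mul_one_div]

theorem invPowFour_apply (n : ℕ) : invPowFour n = 1 / (n : ℝ) ^ 4 := rfl

theorem summable_norm_chiFourDivSq : Summable fun n => ‖chiFourDivSq n‖ := by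
  refine Summable.of_nonneg_of_le (fun _ => norm_nonneg _) (fun n => ?_)
    (Real.summable_one_div_nat_pow.2 one_lt_two)
  rw [chiFourDivSq_apply, norm_div, norm_pow, Real.norm_natCast]
  gcongr
  rcases ZMod.isQuadratic_χ₄ (n : ZMod 4) with h | h | h <;> simp [h]

theorem tsum_chiFourDivSq : ∑' n, chiFourDivSq n = catalanConst := by
  have hodd (k : ℕ) : chiFourDivSq (2 * k + 1) = (-1 : ℝ) ^ k / (2 * (k : ℝ) + 1) ^ 2 := by
    rw [chiFourDivSq_apply, ZMod.χ₄_eq_neg_one_pow (by omega), show (2 * k + 1) / 2 = k by omega]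
    push_cast
    rfl
  have heven (k : ℕ) : chiFourDivSq (2 * k) = 0 := by
    have : ZMod.χ₄ ((2 * k : ℕ) : ZMod 4) = 0 := by
      rw [ZMod.χ₄_nat_eq_if_mod_four, if_pos (by omega)]
    rw [chiFourDivSq_apply, this]
    simp
  have hs : Summable fun k : ℕ => chiFourDivSq (2 * k + 1) :=
    summable_norm_chiFourDivSq.of_norm.comp_injective fun a b h => by
      simpa using h
  have h0 : HasSum (fun k : ℕ => chiFourDivSq (2 * k)) 0 := by
    simp only [heven]; exact hasSum_zero
  rw [(h0.even_add_odd hs.hasSum).tsum_eq, zero_add, catalanConst]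
  exact tsum_congr hodd

theorem abs_sphereCoeff_div_le (n : ℕ) :
    |(sphereCoeff n : ℝ) / (n : ℝ) ^ 3| ≤ 2 * ((n : ℝ) ^ 2)⁻¹ := by
  rcases Nat.eq_zero_or_pos n with rfl | hn
  · simp
  have hn' : (0 : ℝ) < n := Nat.cast_pos.2 hn
  have h : |(sphereCoeff n : ℝ)| ≤ 2 * n := by exact_mod_cast abs_sphereCoeff_le n
  rw [abs_div, abs_of_pos (pow_pos hn' 3), div_le_iff₀ (pow_pos hn' 3)]
  refine h.trans_eq ?_
  field_simp

theorem summable_norm_sphereCoeff_div :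
    Summable fun n : ℕ => ‖(sphereCoeff n : ℝ) / (n : ℝ) ^ 3‖ :=
  Summable.of_nonneg_of_le (fun _ => norm_nonneg _) abs_sphereCoeff_div_le
    ((Real.summable_nat_pow_inv.2 one_lt_two).mul_left 2)

theorem tsum_sphereCoeff_prime_pow {p : ℕ} (hp : p.Prime) (h2 : p ≠ 2) :
    ∑' e, (sphereCoeff (p ^ e) : ℝ) / ((p ^ e : ℕ) : ℝ) ^ 3 = 1 + chiFourDivSq p := by
  rw [tsum_eq_sum (s := Finset.range 2)]
  · have : (p : ℝ) ≠ 0 := Nat.cast_ne_zero.2 hp.ne_zero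
    rw [Finset.sum_range_succ, Finset.sum_range_one, pow_zero, pow_one, sphereCoeff_prime hp,
      isMultiplicative_sphereCoeff.1, chiFourDivSq_apply]
    push_cast
    field_simp
  · intro e he
    have he' : 2 ≤ e := not_lt.1 fun h => he (Finset.mem_range.2 h)
    rw [sphereCoeff_prime_pow hp h2 he']
    simp

theorem tsum_sphereCoeff_two_pow :
    ∑' e, (sphereCoeff (2 ^ e) : ℝ) / ((2 ^ e : ℕ) : ℝ) ^ 3 = 9 / 8 := by
  rw [tsum_eq_sum (s := Finset.range 3)]
  · simp only [Finset.sum_range_succ, Finset.sum_range_zero, pow_zero, pow_one,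
      isMultiplicative_sphereCoeff.1, sphereCoeff_two, show 2 ^ 2 = 4 by norm_num, sphereCoeff_four]
    norm_num
  · intro e he
    have he' : 3 ≤ e := not_lt.1 fun h => he (Finset.mem_range.2 h)
    rw [sphereCoeff_two_pow he']
    simp

/-- Equality of the local factors in `(∑ f(n) / n³) ζ(4) = (6/5) L(2, χ₄)`. At an odd prime it is
`(1 + t) / (1 - t²) = 1 / (1 - t)` with `t = χ₄(p) / p²`; at `2` it is `9/8 · 16/15 = 6/5`. -/
theorem euler_factor_eq (p : Nat.Primes) :
    (∑' e, (sphereCoeff (p ^ e : ℕ) : ℝ) / (((p : ℕ) ^ e : ℕ) : ℝ) ^ 3) * (1 - invPowFour p)⁻¹ =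
      (if (p : ℕ) = 2 then 6 / 5 else 1) * (1 - chiFourDivSq p)⁻¹ := by
  obtain ⟨p, hp⟩ := p
  by_cases h2 : p = 2
  · subst h2
    have : ZMod.χ₄ ((2 : ℕ) : ZMod 4) = 0 := by decide
    rw [if_pos rfl]
    simp only [tsum_sphereCoeff_two_pow, invPowFour_apply, chiFourDivSq_apply, this]
    norm_num
  · rw [if_neg h2]
    simp only
    rw [tsum_sphereCoeff_prime_pow hp h2, one_mul]
    have hsq : chiFourDivSq p ^ 2 = invPowFour p := by
      have : ZMod.χ₄ (p : ZMod 4) ^ 2 = 1 := by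
        have := hp.eq_two_or_odd
        rw [ZMod.χ₄_eq_neg_one_pow (by omega), ← pow_mul, mul_comm, pow_mul]
        norm_num
      rw [chiFourDivSq_apply, invPowFour_apply, div_pow, ← pow_mul]
      congr 1
      exact_mod_cast this
    have hlt : invPowFour p < 1 := by
      rw [invPowFour_apply]
      have : (1 : ℝ) < p := by exact_mod_cast hp.one_lt
      rw [div_lt_one (by positivity)]
      exact one_lt_pow₀ this (by norm_num)
    have h3 : (1 + chiFourDivSq p) * (1 - chiFourDivSq p) = 1 - invPowFour p := by
      rw [← hsq]; ring
    have h4 : 1 - invPowFour p ≠ 0 := by linarith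
    rw [← h3] at h4 ⊢
    obtain ⟨h5, h6⟩ := mul_ne_zero_iff.1 h4
    field_simp

theorem tsum_sphereCoeff_div :
    ∑' n : ℕ, (sphereCoeff n : ℝ) / (n : ℝ) ^ 3 = 108 * catalanConst / Real.pi ^ 4 := by
  have hF := EulerProduct.eulerProduct_hasProd
    (f := fun n : ℕ => (sphereCoeff n : ℝ) / (n : ℝ) ^ 3)
    (by simp [isMultiplicative_sphereCoeff.1])
    (fun {m n} h => by
      rw [isMultiplicative_sphereCoeff.2 h, Int.cast_mul, Nat.cast_mul, mul_pow, mul_div_mul_comm])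
    summable_norm_sphereCoeff_div (by simp)
  have hZ := EulerProduct.eulerProduct_completely_multiplicative_hasProd (f := invPowFour) (by
    simp only [invPowFour_apply]
    exact (Real.summable_one_div_nat_pow.2 (by norm_num)).norm)
  have hL := EulerProduct.eulerProduct_completely_multiplicative_hasProd summable_norm_chiFourDivSq
  have hC : HasProd (fun p : Nat.Primes => if (p : ℕ) = 2 then (6 / 5 : ℝ) else 1)
      (6 / 5) := by
    have := hasProd_single (f := fun p : Nat.Primes => if (p : ℕ) = 2 then (6 / 5 : ℝ) else 1)
      ⟨2, Nat.prime_two⟩ fun q hq => if_neg fun h => hq (Subtype.ext h)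
    simpa only [if_true] using this
  have hR := hC.mul hL
  simp only [← euler_factor_eq] at hR
  have h := (hF.mul hZ).unique hR
  rw [tsum_chiFourDivSq] at h
  simp only [invPowFour_apply] at h
  rw [hasSum_zeta_four.tsum_eq] at h
  rw [eq_div_iff (by positivity)]
  linear_combination 90 * h

/-! ### The asymptotic formula -/

theorem sum_Ioc_sq (N : ℕ) :
    ∑ m ∈ Finset.Ioc 0 N, (m : ℝ) ^ 2 = N * (N + 1) * (2 * N + 1) / 6 := by
  induction N with
  | zero => simp
  | succ N ih =>
    rw [Finset.sum_Ioc_succ_top (Nat.zero_le N), ih]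
    push_cast
    ring

theorem abs_sum_sq_sub_le {y : ℝ} (hy : 1 ≤ y) :
    |∑ m ∈ Finset.Ioc 0 ⌊y⌋₊, (m : ℝ) ^ 2 - y ^ 3 / 3| ≤ 2 * y ^ 2 := by
  rw [sum_Ioc_sq]
  have h1 : (1 : ℝ) ≤ ⌊y⌋₊ := by exact_mod_cast (Nat.one_le_floor_iff y).2 hy
  have h2 := Nat.floor_le (zero_le_one.trans hy)
  have h3 := (Nat.lt_floor_add_one y).le
  generalize (⌊y⌋₊ : ℝ) = t at *
  have h4 : y ^ 3 ≤ (t + 1) ^ 3 := by gcongr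
  have h5 : t ^ 3 ≤ y ^ 3 := by gcongr
  have h6 : t ^ 2 ≤ y ^ 2 := by gcongr
  rw [abs_le]
  constructor <;> nlinarith

theorem abs_sum_sphereCoeff_div_sub_tsum_le {N : ℕ} (hN : N ≠ 0) :
    |∑ d ∈ Finset.Ioc 0 N, (sphereCoeff d : ℝ) / (d : ℝ) ^ 3 -
      ∑' d : ℕ, (sphereCoeff d : ℝ) / (d : ℝ) ^ 3| ≤ 2 / N := by
  have hlim : Tendsto (fun M => ∑ d ∈ Finset.Ioc 0 M, (sphereCoeff d : ℝ) / (d : ℝ) ^ 3) atTop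
      (nhds (∑' d : ℕ, (sphereCoeff d : ℝ) / (d : ℝ) ^ 3)) := by
    have := (summable_norm_sphereCoeff_div.of_norm.hasSum.tendsto_sum_nat).comp
      (tendsto_add_atTop_nat 1)
    refine this.congr fun M => ?_
    refine (Finset.sum_subset (fun d hd => ?_) fun d _ hd => ?_).symm
    · have := Finset.mem_Ioc.1 hd
      exact Finset.mem_range.2 (Nat.lt_succ_of_le this.2)
    · obtain rfl : d = 0 := by simp_all
      simp
  refine le_of_tendsto (hlim.const_sub _).abs ?_
  filter_upwards [eventually_ge_atTop N] with M hM
  rw [abs_sub_comm, ← Finset.sum_Ioc_consecutive _ (Nat.zero_le N) hM, add_sub_cancel_left]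
  calc |∑ d ∈ Finset.Ioc N M, (sphereCoeff d : ℝ) / (d : ℝ) ^ 3|
      ≤ ∑ d ∈ Finset.Ioc N M, 2 * ((d : ℝ) ^ 2)⁻¹ :=
        (Finset.abs_sum_le_sum_abs _ _).trans
          (Finset.sum_le_sum fun d _ => abs_sphereCoeff_div_le d)
    _ ≤ 2 * ((N : ℝ)⁻¹ - (M : ℝ)⁻¹) := by
        rw [← Finset.mul_sum]
        exact mul_le_mul_of_nonneg_left (sum_Ioc_inv_sq_le_sub hN hM) zero_le_two
    _ ≤ 2 / N := by
        rw [div_eq_mul_inv]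
        have : (0 : ℝ) ≤ (M : ℝ)⁻¹ := by positivity
        linarith

/-- Dirichlet's rearrangement of `∑_{r ≤ x} (id² * f)(r)`. -/
theorem sum_numSol_eq (x : ℝ) :
    ∑ r ∈ Finset.Icc 1 ⌊x⌋₊, (numSol 3 1 r : ℝ) = ∑ d ∈ Finset.Ioc 0 ⌊x⌋₊,
      (sphereCoeff d : ℝ) * ∑ m ∈ Finset.Ioc 0 ⌊x / d⌋₊, (m : ℝ) ^ 2 := by
  have h := ArithmeticFunction.sum_Ioc_mul_eq_sum_sum sphereCoeff
    (ArithmeticFunction.pow 2 : ArithmeticFunction ℤ) ⌊x⌋₊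
  rw [mul_comm sphereCoeff, ← numSolArith_eq] at h
  have h' := congrArg (Int.cast : ℤ → ℝ) h
  push_cast at h'
  have e1 : ∑ r ∈ Finset.Icc 1 ⌊x⌋₊, (numSol 3 1 r : ℝ) =
      ∑ n ∈ Finset.Ioc 0 ⌊x⌋₊, (numSolArith n : ℝ) := by
    refine Finset.sum_congr (by ext; simp [Nat.succ_le_iff]) fun r hr => ?_
    rw [numSolArith_apply (Finset.mem_Ioc.1 hr).1.ne', Int.cast_natCast]
  rw [e1, h']
  refine Finset.sum_congr rfl fun d _ => ?_
  rw [Nat.floor_div_natCast]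
  congr 1
  refine Finset.sum_congr rfl fun m _ => ?_
  simp [ArithmeticFunction.pow_apply]

theorem abs_sum_numSol_sub_le {x : ℝ} (hx : 1 ≤ x) :
    |∑ r ∈ Finset.Icc 1 ⌊x⌋₊, (numSol 3 1 r : ℝ) - 36 * catalanConst / Real.pi ^ 4 * x ^ 3| ≤
      x ^ 2 * (6 + 4 * Real.log x) := by
  have hx0 : 0 < x := zero_lt_one.trans_le hx
  have hN1 : 1 ≤ ⌊x⌋₊ := (Nat.one_le_floor_iff x).2 hx
  set N := ⌊x⌋₊ with hN
  set S := ∑ d ∈ Finset.Ioc 0 N, (sphereCoeff d : ℝ) / (d : ℝ) ^ 3 with hS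
  set T := ∑' d : ℕ, (sphereCoeff d : ℝ) / (d : ℝ) ^ 3
  -- replace the inner sum of squares by `(x / d) ^ 3 / 3` and the sum over `d` by the full series
  have hmain : ∑ r ∈ Finset.Icc 1 N, (numSol 3 1 r : ℝ)
      - 36 * catalanConst / Real.pi ^ 4 * x ^ 3 =
      ∑ d ∈ Finset.Ioc 0 N, (sphereCoeff d : ℝ) *
        (∑ m ∈ Finset.Ioc 0 ⌊x / d⌋₊, (m : ℝ) ^ 2 - (x / d) ^ 3 / 3) + x ^ 3 / 3 * (S - T) := by
    rw [hN, sum_numSol_eq, ← hN]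
    have e1 : ∑ d ∈ Finset.Ioc 0 N, (sphereCoeff d : ℝ) * ((x / d) ^ 3 / 3) = x ^ 3 / 3 * S := by
      rw [hS, Finset.mul_sum]
      refine Finset.sum_congr rfl fun d _ => ?_
      rw [div_pow]; ring
    have e2 : T = 108 * catalanConst / Real.pi ^ 4 := tsum_sphereCoeff_div
    simp only [mul_sub, Finset.sum_sub_distrib]
    rw [e1, e2]
    ring
  have h1 : |∑ d ∈ Finset.Ioc 0 N, (sphereCoeff d : ℝ) *
      (∑ m ∈ Finset.Ioc 0 ⌊x / d⌋₊, (m : ℝ) ^ 2 - (x / d) ^ 3 / 3)| ≤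
      4 * x ^ 2 * (1 + Real.log x) := by
    have hterm (d : ℕ) (hd : d ∈ Finset.Ioc 0 N) : |(sphereCoeff d : ℝ) *
        (∑ m ∈ Finset.Ioc 0 ⌊x / d⌋₊, (m : ℝ) ^ 2 - (x / d) ^ 3 / 3)| ≤
        4 * x ^ 2 * (d : ℝ)⁻¹ := by
      obtain ⟨hd0, hdN⟩ := Finset.mem_Ioc.1 hd
      have hd0' : (0 : ℝ) < d := Nat.cast_pos.2 hd0
      have hdx : (d : ℝ) ≤ x := (Nat.le_floor_iff hx0.le).1 hdN
      have hf : |(sphereCoeff d : ℝ)| ≤ 2 * d := by exact_mod_cast abs_sphereCoeff_le d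
      rw [abs_mul]
      refine (mul_le_mul hf (abs_sum_sq_sub_le ((one_le_div hd0').2 hdx)) (abs_nonneg _)
        (by positivity)).trans_eq ?_
      field_simp
      ring
    have hharm : ∑ d ∈ Finset.Ioc 0 N, (d : ℝ)⁻¹ ≤ 1 + Real.log x := by
      refine le_trans (le_of_eq ?_) (harmonic_floor_le_one_add_log x hx)
      rw [harmonic_eq_sum_Icc]
      push_cast
      exact Finset.sum_congr (by ext; simp [Nat.succ_le_iff, hN]) fun _ _ => rfl
    calc _ ≤ ∑ d ∈ Finset.Ioc 0 N, 4 * x ^ 2 * (d : ℝ)⁻¹ :=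
          (Finset.abs_sum_le_sum_abs _ _).trans (Finset.sum_le_sum hterm)
      _ ≤ _ := by rw [← Finset.mul_sum]; gcongr
  have h2 : |x ^ 3 / 3 * (S - T)| ≤ 2 * x ^ 2 := by
    have hNx : x ≤ 2 * N := by
      have := (Nat.lt_floor_add_one x).le
      have h1' : (1 : ℝ) ≤ N := by exact_mod_cast hN1
      rw [← hN] at this
      linarith
    have hN0 : (0 : ℝ) < N := by exact_mod_cast hN1
    rw [abs_mul, abs_of_pos (by positivity : 0 < x ^ 3 / 3)]
    calc x ^ 3 / 3 * |S - T| ≤ x ^ 3 / 3 * (2 / N) := by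
          gcongr
          exact abs_sum_sphereCoeff_div_sub_tsum_le (by omega)
      _ ≤ x ^ 3 / 3 * (2 / (x / 2)) := by
          gcongr
          linarith
      _ ≤ 2 * x ^ 2 := by
          have : x ^ 3 / 3 * (2 / (x / 2)) = 4 / 3 * x ^ 2 := by field_simp; norm_num
          rw [this]
          nlinarith [sq_nonneg x]
  rw [hmain]
  calc _ ≤ _ := abs_add_le _ _
    _ ≤ 4 * x ^ 2 * (1 + Real.log x) + 2 * x ^ 2 := add_le_add h1 h2
    _ = _ := by ring

theorem proposition8p13 :
    ((fun x : ℝ => (∑ r ∈ Finset.Icc 1 ⌊x⌋₊, (numSol 3 1 r : ℝ))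
        - 36 * catalanConst / Real.pi ^ 4 * x ^ 3)
      =O[atTop] (fun x : ℝ => x ^ 2 * Real.log x)) ∧
    ∃ f : ArithmeticFunction ℤ,
      f.IsMultiplicative ∧
      (∀ p ν : ℕ, p.Prime → 1 ≤ ν → f (p ^ ν) = fPrimePow p ν) ∧
      ∀ r : ℕ, 1 ≤ r →
        (numSol 3 1 r : ℤ) = ((ArithmeticFunction.pow 2 : ArithmeticFunction ℤ) * f) r := by
  refine ⟨?_, sphereCoeff, isMultiplicative_sphereCoeff,
    fun p ν hp hν => sphereCoeff_eq_fPrimePow hp hν, fun r hr => ?_⟩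
  · refine IsBigO.of_bound 10 ?_
    filter_upwards [eventually_ge_atTop (Real.exp 1)] with x hx
    -- `1 ≤ log x` absorbs the term `6 x ^ 2` of the explicit bound
    have hlog : 1 ≤ Real.log x := (Real.le_log_iff_exp_le ((Real.exp_pos 1).trans_le hx)).2 hx
    have hx1 : 1 ≤ x := (Real.one_le_exp zero_le_one).trans hx
    rw [Real.norm_eq_abs, Real.norm_eq_abs, abs_of_nonneg (a := x ^ 2 * Real.log x) (by positivity)]
    refine (abs_sum_numSol_sub_le hx1).trans ?_
    nlinarith [sq_nonneg x]
  · rw [← numSolArith_apply (by omega), numSolArith_eq]
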